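/- Let $\mathbb{K}$ be $\mathbb{R}$ or $\mathbb{C}$. For $0<p<\infty$ let $L_p[0,1]$ be the space of (Lebesgue classes of) measurable functions $f\colon[0,1]\to\mathbb{K}$ with $\|f\|_p=\left(\int_0^1|f|^p\right)^{1/p}<\infty$, with the topology given by the norm $\|\cdot\|_p$ (the $p$-norm $\|\cdot\|_p$ if $p<1$). Let $E$ be a topological space that is also a vector space over $\mathbb{K}$, let $A\subset E$, and let $\alpha\le\beta$ be cardinal numbers. The set $A$ is called $(\alpha,\beta)$-spaceable in $E$ if (i) there is a linear subspace $F\subset E$ with $\dim F=\alpha$ and $F\smallsetminus\{0\}\subset A$, and (ii) for every linear subspace $F\subset E$ with $\dim F=\alpha$ and $F\subset A\cup\{0\}$ there is a closed linear subspace $G\subset E$ with $\dim G=\beta$ and $F\subset G\subset A\cup\{0\}$; if $\alpha>\beta$, then no set is $(\alpha,\beta)$-spaceable. Write $\mathfrak{c}=\operatorname{card}(\mathbb{R})$. **Theorem.** For every $0<p<\infty$ and every cardinal number $\alpha$, the set $$L_p[0,1]\smallsetminus\bigcup_{q\in(p,\infty)}L_q[0,1]$$ is $(\alpha,\mathfrak{c})$-spaceable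 in $L_p[0,1]$ if and only if $\alpha<\aleph_0$. -/

import Mathlib

open MeasureTheory Set
open scoped ENNReal Cardinal Topology

/-- A subset `A` of a `𝕜`-vector space `E` is `α`-lineable if `E` has a linear subspace `F` of
dimension `α` with `F \ {0} ⊆ A`. -/
def IsLineable (𝕜 : Type*) {E : Type*} [Field 𝕜] [AddCommGroup E] [Module 𝕜 E]
    (A : Set E) (α : Cardinal) : Prop :=
  ∃ F : Submodule 𝕜 E, Module.rank 𝕜 F = α ∧ (F : Set E) \ {0} ⊆ A

/-- A subset `A` of a `𝕜`-vector space `E` with topology `τ` is `(α, β)`-spaceable (`α ≤ β`) if it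
is `α`-lineable and every `α`-dimensional subspace `F ⊆ A ∪ {0}` is contained in a `τ`-closed
`β`-dimensional subspace `G ⊆ A ∪ {0}`. -/
def IsSpaceable (𝕜 : Type*) {E : Type*} [Field 𝕜] [AddCommGroup E] [Module 𝕜 E]
    (τ : TopologicalSpace E) (A : Set E) (α β : Cardinal) : Prop :=
  α ≤ β ∧ IsLineable 𝕜 A α ∧
    ∀ F : Submodule 𝕜 E, Module.rank 𝕜 F = α → (F : Set E) ⊆ A ∪ {0} →
      ∃ G : Submodule 𝕜 E, Module.rank 𝕜 G = β ∧ IsClosed[τ] (G : Set E) ∧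
        F ≤ G ∧ (G : Set E) ⊆ A ∪ {0}

/-- Lebesgue measure on the interval `[0, 1]`. -/
noncomputable abbrev unitMeasure : Measure ℝ := volume.restrict (Icc (0 : ℝ) 1)

/-- `L_p[0,1]`, as classes of measurable functions modulo equality almost everywhere. -/
abbrev LpUnit (𝕜 : Type*) [RCLike 𝕜] (p : ℝ≥0∞) : Type _ := Lp 𝕜 p unitMeasure

/-- The topology of `L_p[0,1]`, `0 < p < ∞`, induced by `‖f‖ = (∫ |f|^p)^(1/p)`: a set is open if
with each of its points `f` it contains a ball `{g | ‖g - f‖ < ε}`. For `p ≥ 1` it is the norm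
topology, and for `p < 1` it is the topology of the metric `‖g - f‖^p`. (Mathlib gives `Lp` a
topology only for `p ≥ 1`.) -/
@[reducible] def lpUnitTopology (𝕜 : Type*) [RCLike 𝕜] (p : ℝ≥0∞) : TopologicalSpace (LpUnit 𝕜 p) where
  IsOpen U := ∀ f ∈ U, ∃ ε : ℝ, 0 < ε ∧ ∀ g : LpUnit 𝕜 p, ‖g - f‖ < ε → g ∈ U
  isOpen_univ := fun _ _ => ⟨1, one_pos, fun _ _ => mem_univ _⟩
  isOpen_inter := by
    rintro U V hU hV f ⟨hfU, hfV⟩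
    obtain ⟨a, ha, hUa⟩ := hU f hfU
    obtain ⟨b, hb, hVb⟩ := hV f hfV
    exact ⟨min a b, lt_min ha hb, fun g hg =>
      ⟨hUa g (hg.trans_le (min_le_left _ _)), hVb g (hg.trans_le (min_le_right _ _))⟩⟩
  isOpen_sUnion := by
    rintro S hS f ⟨U, hU, hf⟩
    obtain ⟨ε, hε, h⟩ := hS U hU f hf
    exact ⟨ε, hε, fun g hg => ⟨U, hU, h g hg⟩⟩

/-- The set `L_p[0,1] \ ⋃_{q ∈ (p, ∞)} L_q[0,1]`, as a subset of `L_p[0,1]`; all the spaces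
`L_q[0,1]` sit inside the space of classes of measurable functions. -/
def lpDiffLq (𝕜 : Type*) [RCLike 𝕜] (p : ℝ≥0∞) : Set (LpUnit 𝕜 p) :=
  {f | (f : ℝ →ₘ[unitMeasure] 𝕜) ∉
    ⋃ q ∈ Ioo p ∞, (Lp 𝕜 q unitMeasure : Set (ℝ →ₘ[unitMeasure] 𝕜))}

open Filter

/-! If `F` is finite-dimensional, its members are all essentially bounded on one set `B` of positive
measure (`exists_bounded_on_of_fg`). Inside `B` lie disjoint pieces of geometrically decaying
measure, and a sequence `c` is turned into a step function on them that lies in no `L_q`, `q > p`,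
unless `c = 0`. Let `V` be the space of all these functions plus `F`, and `G` the part of `V` in
`L_p`. An element of `V` agrees off `B` with its component `u` in `F`, and `u` is bounded on `B`, so
a nonzero `u` keeps it out of `L_q`. `V` is closed under a.e. limits of sequences, and `L_p`
convergence yields a.e. convergent subsequences, so `G` is closed.

If `α` is infinite, an `α`-dimensional `F₀` is sheared along the constant `1`, which destroys no
singularity, so that `1` becomes a limit of vectors of the new space
(`exists_submodule_not_le_closed`). Every closed `G` above it then contains `1`, which lies in every
`L_q`. -/

theorem mem_lpDiffLq_iff {𝕜 : Type*} [RCLike 𝕜] {p : ℝ≥0∞} {f : LpUnit 𝕜 p} :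
    f ∈ lpDiffLq 𝕜 p ↔ ∀ q, p < q → q < ∞ → ¬ MemLp (f : ℝ → 𝕜) q unitMeasure := by
  simp only [lpDiffLq, mem_ofPred_eq, mem_iUnion, mem_Ioo, SetLike.mem_coe, Lp.mem_Lp_iff_memLp]
  push Not
  constructor
  · exact fun h q h1 h2 => h q ⟨h1, h2⟩
  · exact fun h q h12 => h q h12.1 h12.2

/-! ### Disjoint pieces of prescribed measure -/

/-- A finite atomless measure on the line takes all intermediate values on half-lines. -/
theorem exists_measure_Iic_eq (μ : Measure ℝ) [IsFiniteMeasure μ] [NullSingletonClass μ] {t : ℝ≥0∞}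
    (h0 : 0 < t) (h1 : t < μ univ) : ∃ x, μ (Iic x) = t := by
  have ht : t ≠ ∞ := h1.ne_top
  have hc : Continuous fun x => μ.real (Iic x) := by
    have h := (intervalIntegral.continuous_primitive (μ := μ) (f := fun _ => (1 : ℝ))
      (fun a b => (integrable_const 1).intervalIntegrable) 0).add_const (μ.real (Iic 0))
    convert h using 2 with x
    rw [← intervalIntegral.integral_Iic_sub_Iic (integrable_const 1).integrableOn
      (integrable_const 1).integrableOn]
    simp
  have htop : ∃ x, t.toReal ≤ μ.real (Iic x) := by
    obtain ⟨x, hx⟩ := ((tendsto_measure_Iic_atTop μ).eventually (lt_mem_nhds h1)).exists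
    exact ⟨x, (ENNReal.toReal_le_toReal ht (measure_ne_top _ _)).2 hx.le⟩
  have hlim : Tendsto (fun x => μ (Iic x)) atBot (𝓝 0) := by
    have h := tendsto_measure_iInter_atBot (μ := μ)
      (fun x : ℝ => measurableSet_Iic.nullMeasurableSet) monotone_Iic ⟨0, measure_ne_top μ _⟩
    rwa [iInter_Iic_eq_empty_iff.2 (by simp [not_bddBelow_univ]), measure_empty] at h
  have hbot : ∃ x, μ.real (Iic x) ≤ t.toReal := by
    obtain ⟨x, hx⟩ := (hlim.eventually (gt_mem_nhds h0)).exists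
    exact ⟨x, (ENNReal.toReal_le_toReal (measure_ne_top _ _) ht).2 hx.le⟩
  obtain ⟨x, hx⟩ := mem_range_of_exists_le_of_exists_ge hc hbot htop
  exact ⟨x, (ENNReal.toReal_eq_toReal_iff' (measure_ne_top _ _) ht).1 hx⟩

/-- A set of positive measure contains disjoint pieces of geometrically decaying positive measure,
recorded by a measurable labelling that is `0` off the set. -/
theorem exists_measurable_label (μ : Measure ℝ) [IsFiniteMeasure μ] [NullSingletonClass μ] {B : Set ℝ}
    (hB : MeasurableSet B) (hμB : μ B ≠ 0) :
    ∃ s : ℝ → ℕ, Measurable s ∧ (∀ x ∉ B, s x = 0) ∧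
      ∀ n, μ (s ⁻¹' {n + 1}) = μ B * 2⁻¹ ^ (n + 2) := by
  have hBt : μ B ≠ ∞ := measure_ne_top _ _
  -- The pieces are cut from `B` by the quantiles `x n`, which decrease with `n`.
  have hx : ∀ n : ℕ, ∃ x, μ.restrict B (Iic x) = μ B * 2⁻¹ ^ (n + 1) := by
    intro n
    apply exists_measure_Iic_eq
    · exact ENNReal.mul_pos hμB (by simp)
    · rw [Measure.restrict_apply_univ]
      conv_rhs => rw [← mul_one (μ B)]
      exact (ENNReal.mul_lt_mul_iff_right hμB hBt).2 (pow_lt_one₀ (by simp) (by norm_num) (by simp))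
  choose x hx using hx
  have hlt : ∀ n, x (n + 1) < x n := by
    intro n
    by_contra h
    have := (measure_mono (Iic_subset_Iic.2 (not_lt.1 h)) : μ.restrict B _ ≤ μ.restrict B _)
    rw [hx, hx, ENNReal.mul_le_mul_iff_right hμB hBt] at this
    rw [← ENNReal.inv_pow, ← ENNReal.inv_pow, ENNReal.inv_le_inv] at this
    exact absurd this (not_le.2 (by exact_mod_cast Nat.pow_lt_pow_right one_lt_two (by omega)))
  have hanti : Antitone x := antitone_nat_of_succ_le fun n => (hlt n).le
  have hdisj := hanti.pairwise_disjoint_on_Ioc_succ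
  let P : ℕ → Set ℝ := fun n => B ∩ Ioc (x (n + 1)) (x n)
  have hPm : ∀ n, MeasurableSet (P n) := fun n => hB.inter measurableSet_Ioc
  have hPd : Pairwise (Function.onFun Disjoint P) := fun i j hij =>
    (hdisj hij).mono inter_subset_right inter_subset_right
  -- Label `0` collects everything outside the pieces; `blockSeq` vanishes there.
  let t : ℕ → Set ℝ := fun n => Nat.casesOn n (⋃ n, P n)ᶜ P
  obtain ⟨s, hs, hst⟩ := exists_measurable_piecewise t
    (by rintro (_ | n); exacts [(MeasurableSet.iUnion hPm).compl, hPm n])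
    (fun n _ => n) (fun n => measurable_const) (by
      have hd : Pairwise (Function.onFun Disjoint t) := by
        rintro (_ | i) (_ | j) hij
        · exact absurd rfl hij
        · exact disjoint_compl_left_iff_subset.2 (subset_iUnion P j)
        · exact disjoint_compl_right_iff_subset.2 (subset_iUnion P i)
        · exact hPd (by simpa using hij)
      intro i j hij y hy
      exact absurd hy (by rw [(hd hij).inter_eq]; exact notMem_empty _))
  have hs0 : ∀ y ∉ ⋃ n, P n, s y = 0 := fun y hy => hst 0 hy
  refine ⟨s, hs, fun y hy => hs0 y ?_, fun n => ?_⟩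
  · simp only [mem_iUnion, not_exists]
    exact fun n h => hy h.1
  · have : s ⁻¹' {n + 1} = P n := by
      ext y
      simp only [mem_preimage, mem_singleton_iff]
      refine ⟨fun h => ?_, fun h => hst (n + 1) h⟩
      by_cases hy : y ∈ ⋃ n, P n
      · obtain ⟨m, hm⟩ := mem_iUnion.1 hy
        have h' : s y = m + 1 := hst (m + 1) hm
        have : m = n := by omega
        exact this ▸ hm
      · rw [hs0 y hy] at h
        omega
    have h2 : P n = Ioc (x (n + 1)) (x n) ∩ B := inter_comm _ _
    rw [this, h2, ← Measure.restrict_apply measurableSet_Ioc, ← Iic_sdiff_Iic,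
      measure_sdiff (Iic_subset_Iic.2 (hlt n).le) measurableSet_Iic.nullMeasurableSet
        (measure_ne_top _ _), hx, hx]
    apply ENNReal.sub_eq_of_eq_add (by finiteness)
    rw [← mul_add, ← two_mul, pow_succ' _ (n + 1), ← mul_assoc 2,
      ENNReal.mul_inv_cancel (by simp) (by simp), one_mul]

/-! ### Closedness under almost everywhere convergence -/

/-- A submodule of classes of functions that is closed under almost everywhere convergence of
sequences. -/
def AESeqClosed {𝕜 X : Type*} [RCLike 𝕜] [MeasurableSpace X] {μ : Measure X}
    (V : Submodule 𝕜 (X →ₘ[μ] 𝕜)) : Prop :=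
  ∀ (v : ℕ → X →ₘ[μ] 𝕜) (f : X →ₘ[μ] 𝕜), (∀ j, v j ∈ V) →
    (∀ᵐ x ∂μ, Tendsto (fun j => v j x) atTop (𝓝 (f x))) → f ∈ V

theorem AESeqClosed.sup_span_singleton {𝕜 X : Type*} [RCLike 𝕜] [MeasurableSpace X]
    {μ : Measure X} {V : Submodule 𝕜 (X →ₘ[μ] 𝕜)} (hV : AESeqClosed V) (u : X →ₘ[μ] 𝕜) :
    AESeqClosed (V ⊔ Submodule.span 𝕜 {u}) := by
  by_cases huV : u ∈ V
  · rwa [sup_eq_left.2 ((Submodule.span_singleton_le_iff_mem u V).2 huV)]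
  intro v f hv hlim
  have hv' : ∀ j, ∃ w ∈ V, ∃ t : 𝕜, w + t • u = v j := by
    intro j
    obtain ⟨w, hw, z, hz, h⟩ := Submodule.mem_sup.1 (hv j)
    obtain ⟨t, rfl⟩ := Submodule.mem_span_singleton.1 hz
    exact ⟨w, hw, t, h⟩
  choose w hw t hwt using hv'
  have hpt : ∀ᵐ x ∂μ, ∀ j, v j x = w j x + t j * u x := by
    rw [ae_all_iff]
    intro j
    filter_upwards [AEEqFun.coeFn_add (w j) (t j • u), AEEqFun.coeFn_smul (t j) u] with x h1 h2
    rw [← hwt, h1, Pi.add_apply, h2, Pi.smul_apply, smul_eq_mul]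
  -- If `‖t j‖ → ∞`, dividing by `t j` exhibits `-u` as an a.e. limit from `V`, contradicting `u ∉
  -- V`. Otherwise a subsequence of `t` converges, and the components in `V` converge along it.
  by_cases hb : Tendsto (fun j => ‖t j‖) atTop atTop
  · exfalso
    apply huV
    rw [← neg_mem_iff]
    refine hV (fun j => (t j)⁻¹ • w j) (-u) (fun j => V.smul_mem _ (hw j)) ?_
    have hw' : ∀ᵐ x ∂μ, ∀ j, ((t j)⁻¹ • w j : X →ₘ[μ] 𝕜) x = (t j)⁻¹ * w j x := by
      rw [ae_all_iff]
      intro j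
      filter_upwards [AEEqFun.coeFn_smul (t j)⁻¹ (w j)] with x h
      rw [h, Pi.smul_apply, smul_eq_mul]
    have hti : Tendsto (fun j => (t j)⁻¹) atTop (𝓝 0) :=
      tendsto_inv₀_cobounded.comp (tendsto_norm_atTop_iff_cobounded.1 hb)
    filter_upwards [hlim, hpt, hw', AEEqFun.coeFn_neg u] with x h1 h2 h3 h4
    rw [h4, Pi.neg_apply]
    have h5 := (hti.mul h1).sub_const (u x)
    rw [zero_mul, zero_sub] at h5
    refine h5.congr' ?_
    filter_upwards [hb.eventually_gt_atTop 0] with j hj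
    have : t j ≠ 0 := norm_pos_iff.1 hj
    rw [h3, h2]
    field_simp
    ring
  · obtain ⟨R, hR⟩ : ∃ R : ℝ, ∃ᶠ j in atTop, ‖t j‖ ≤ R := by
      simp only [tendsto_atTop, not_forall] at hb
      obtain ⟨R, hR⟩ := hb
      exact ⟨R, (not_eventually.1 hR).mono fun j hj => (not_le.1 hj).le⟩
    obtain ⟨t₀, -, φ, hφ, hφt⟩ := tendsto_subseq_of_frequently_bounded
      (Metric.isBounded_closedBall (x := (0 : 𝕜)) (r := R)) (x := t) (hR.mono fun j hj => by simpa)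
    have hfV : f - t₀ • u ∈ V := by
      refine hV (fun j => w (φ j)) _ (fun j => hw _) ?_
      filter_upwards [hlim, hpt, AEEqFun.coeFn_sub f (t₀ • u), AEEqFun.coeFn_smul t₀ u]
        with x h1 h2 h3 h4
      rw [h3, Pi.sub_apply, h4, Pi.smul_apply, smul_eq_mul]
      refine ((h1.comp hφ.tendsto_atTop).sub (hφt.mul_const (u x))).congr fun j => ?_
      simp [h2]
    rw [← sub_add_cancel f (t₀ • u)]
    exact Submodule.add_mem_sup hfV (Submodule.smul_mem _ _ (Submodule.mem_span_singleton_self u))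

theorem AESeqClosed.sup_fg {𝕜 X : Type*} [RCLike 𝕜] [MeasurableSpace X]
    {μ : Measure X} {V : Submodule 𝕜 (X →ₘ[μ] 𝕜)} (hV : AESeqClosed V)
    {F : Submodule 𝕜 (X →ₘ[μ] 𝕜)} (hF : F.FG) : AESeqClosed (V ⊔ F) := by
  induction F, hF using Submodule.fg_induction generalizing V with
  | singleton u => exact hV.sup_span_singleton u
  | sup F₁ F₂ _ _ h₁ h₂ => rw [← sup_assoc]; exact h₂ (h₁ hV)

/-- An almost everywhere sequentially closed space of functions cuts out a closed subspace of
`L_p[0,1]`. -/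
theorem AESeqClosed.isClosed_comap {𝕜 : Type*} [RCLike 𝕜] {p : ℝ≥0∞} (hp : p ≠ 0)
    {V : Submodule 𝕜 (ℝ →ₘ[unitMeasure] 𝕜)} (hV : AESeqClosed V) :
    IsClosed[lpUnitTopology 𝕜 p] {f : LpUnit 𝕜 p | (f : ℝ →ₘ[unitMeasure] 𝕜) ∈ V} := by
  let := lpUnitTopology 𝕜 p
  rw [← isOpen_compl_iff]
  intro f hf
  by_contra! hcon
  choose g hg hgV using fun j : ℕ => hcon (1 / ((j : ℝ) + 1)) Nat.one_div_pos_of_nat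
  have hgV' : ∀ j, (g j : ℝ →ₘ[unitMeasure] 𝕜) ∈ V := fun j => not_not.1 (hgV j)
  have hlim : Tendsto (fun j => eLpNorm (fun x => g j x - f x) p unitMeasure) atTop (𝓝 0) := by
    have h0 : Tendsto (fun j => ENNReal.ofReal ‖g j - f‖) atTop (𝓝 0) := by
      rw [← ENNReal.ofReal_zero]
      exact ENNReal.tendsto_ofReal (squeeze_zero (fun j => ENNReal.toReal_nonneg)
        (fun j => (hg j).le) tendsto_one_div_add_atTop_nhds_zero_nat)
    refine h0.congr fun j => ?_
    rw [Lp.norm_def, ENNReal.ofReal_toReal (Lp.eLpNorm_ne_top _)]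
    exact eLpNorm_congr_ae (Lp.coeFn_sub (g j) f)
  obtain ⟨φ, hφ, hae⟩ := (tendstoInMeasure_of_tendsto_eLpNorm hp
    (fun j => Lp.aestronglyMeasurable (g j)) (Lp.aestronglyMeasurable f) hlim).exists_seq_tendsto_ae
  exact hf (hV (fun j => g (φ j)) f (fun j => hgV' _) hae)

/-! ### Step functions in `L_p` and in no larger `L_q` -/

/-- The sequence with value `c k * (2 ^ m / (m + 1) ^ 2) ^ (1 / p)` at `m + 1`, where `k` is the
first component of `m` under the pairing bijection. -/
noncomputable def blockSeq {𝕜 : Type*} [RCLike 𝕜] (p : ℝ) (c : ℕ → 𝕜) : ℕ → 𝕜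
  | 0 => 0
  | m + 1 => c (Nat.unpair m).1 * (((2 ^ m / ((m : ℝ) + 1) ^ 2) ^ p⁻¹ : ℝ) : 𝕜)

theorem norm_blockSeq_succ {𝕜 : Type*} [RCLike 𝕜] (p : ℝ) (c : ℕ → 𝕜) (m : ℕ) :
    ‖blockSeq p c (m + 1)‖ = ‖c (Nat.unpair m).1‖ * (2 ^ m / ((m : ℝ) + 1) ^ 2) ^ p⁻¹ := by
  rw [blockSeq, norm_mul, RCLike.norm_ofReal, abs_of_nonneg (by positivity)]

/-- The term is `2 ^ (m (q / p - 1))` over `4 (m + 1) ^ (2 q / p)`: an exponential beats a power. -/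
theorem tendsto_blockSeq_growth {p q : ℝ} (hp : 0 < p) (hpq : p < q) :
    Tendsto (fun m : ℕ => ((2 ^ m / ((m : ℝ) + 1) ^ 2) ^ p⁻¹) ^ q * (1 / 2 : ℝ) ^ (m + 2))
      atTop atTop := by
  set b : ℝ := (q / p - 1) * Real.log 2 with hbdef
  have hb : 0 < b := mul_pos (sub_pos.2 ((one_lt_div hp).2 hpq)) (Real.log_pos one_lt_two)
  have h1 := (tendsto_exp_mul_div_rpow_atTop (2 * (q / p)) b hb).comp
    (tendsto_natCast_atTop_atTop.comp (tendsto_add_atTop_nat 1))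
  refine (h1.const_mul_atTop (by positivity : 0 < Real.exp (-b) / 4)).congr fun m => ?_
  have hm : (0 : ℝ) < (m : ℝ) + 1 := by positivity
  have e1 : ((2 ^ m / ((m : ℝ) + 1) ^ 2) ^ p⁻¹) ^ q
      = Real.exp (m * (q / p) * Real.log 2) / ((m : ℝ) + 1) ^ (2 * (q / p)) := by
    rw [← Real.rpow_mul (by positivity), Real.div_rpow (by positivity) (by positivity),
      ← Real.rpow_natCast 2 m, ← Real.rpow_mul two_pos.le, ← Real.rpow_natCast _ 2,
      ← Real.rpow_mul hm.le, Real.rpow_def_of_pos two_pos, inv_mul_eq_div]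
    push_cast
    ring_nf
  have e2 : (1 / 2 : ℝ) ^ (m + 2) = Real.exp (-(m * Real.log 2)) / 4 := by
    rw [Real.exp_neg, mul_comm, ← Real.rpow_def_of_pos two_pos, Real.rpow_natCast, pow_add, one_div, inv_pow]
    ring
  have e3 : Real.exp (-b) * Real.exp (b * ((m : ℝ) + 1))
      = Real.exp (m * (q / p) * Real.log 2) * Real.exp (-(m * Real.log 2)) := by
    rw [← Real.exp_add, ← Real.exp_add, hbdef]
    ring_nf
  rw [e1, e2, div_mul_div_comm, ← e3, mul_comm _ (4 : ℝ), ← div_mul_div_comm]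
  simp only [Function.comp_apply, Nat.cast_add, Nat.cast_one]

section Label

variable {𝕜 X : Type*} [RCLike 𝕜] [MeasurableSpace X] {μ : Measure X} {s : X → ℕ} {L : ℝ≥0∞}

theorem lintegral_comp_label (hs : Measurable s)
    (hsL : ∀ n, μ (s ⁻¹' {n + 1}) = L * 2⁻¹ ^ (n + 2)) (φ : ℕ → ℝ≥0∞) (hφ : φ 0 = 0) :
    ∫⁻ x, φ (s x) ∂μ = ∑' m, φ (m + 1) * (L * 2⁻¹ ^ (m + 2)) := by
  rw [← lintegral_map (μ := μ) (measurable_of_countable φ) hs, lintegral_countable',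
    tsum_eq_zero_add' ENNReal.summable, hφ, zero_mul, zero_add]
  refine tsum_congr fun m => ?_
  rw [Measure.map_apply hs (measurableSet_singleton _), hsL]

theorem stronglyMeasurable_blockSeq_comp (hs : Measurable s) (p : ℝ) (c : ℕ → 𝕜) :
    StronglyMeasurable fun x => blockSeq p c (s x) :=
  ((measurable_of_countable (blockSeq p c)).comp hs).stronglyMeasurable

theorem inv_two_pow_eq_ofReal (n : ℕ) : (2⁻¹ : ℝ≥0∞) ^ n = ENNReal.ofReal ((1 / 2 : ℝ) ^ n) := by
  rw [ENNReal.ofReal_pow (by norm_num), one_div, ENNReal.ofReal_inv_of_pos two_pos]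
  simp

/-- For the exponent `p` the powers of two cancel, and the integral is dominated by `∑ L / (m + 1) ^
2`. -/
theorem memLp_blockSeq_comp {p : ℝ≥0∞} (hp0 : p ≠ 0) (hp : p ≠ ∞) (hs : Measurable s)
    (hL : L ≠ ∞) (hsL : ∀ n, μ (s ⁻¹' {n + 1}) = L * 2⁻¹ ^ (n + 2)) {c : ℕ → 𝕜}
    (hc : ∀ k, ‖c k‖ ≤ 1) : MemLp (fun x => blockSeq p.toReal c (s x)) p μ := by
  have hpr : 0 < p.toReal := ENNReal.toReal_pos hp0 hp
  refine ⟨(stronglyMeasurable_blockSeq_comp hs _ c).aestronglyMeasurable, ?_⟩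
  rw [eLpNorm_lt_top_iff_lintegral_rpow_enorm_lt_top hp0 hp,
    lintegral_comp_label hs hsL (fun n => ‖blockSeq p.toReal c n‖ₑ ^ p.toReal)
      (by simp [blockSeq, hpr])]
  have hsum : Summable fun m : ℕ => 1 / ((m : ℝ) + 1) ^ 2 := by
    exact_mod_cast (summable_nat_add_iff 1).2 (Real.summable_one_div_nat_pow.2 one_lt_two)
  refine lt_of_le_of_lt (ENNReal.tsum_le_tsum (g := fun m : ℕ =>
    L * ENNReal.ofReal (1 / ((m : ℝ) + 1) ^ 2)) fun m => ?_) ?_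
  · rw [mul_left_comm]
    gcongr
    rw [← ofReal_norm, ENNReal.ofReal_rpow_of_nonneg (norm_nonneg _) hpr.le,
      inv_two_pow_eq_ofReal, ← ENNReal.ofReal_mul (by positivity)]
    apply ENNReal.ofReal_le_ofReal
    rw [norm_blockSeq_succ]
    calc (‖c (Nat.unpair m).1‖ * (2 ^ m / ((m : ℝ) + 1) ^ 2) ^ p.toReal⁻¹) ^ p.toReal
          * (1 / 2) ^ (m + 2)
        ≤ (1 * (2 ^ m / ((m : ℝ) + 1) ^ 2) ^ p.toReal⁻¹) ^ p.toReal * (1 / 2) ^ (m + 2) := by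
          gcongr
          exact hc _
      _ = 1 / 4 * (1 / ((m : ℝ) + 1) ^ 2) := by
          rw [one_mul, ← Real.rpow_mul (by positivity), inv_mul_cancel₀ hpr.ne', Real.rpow_one,
            pow_add, one_div_pow]
          field_simp
          norm_num
      _ ≤ 1 / ((m : ℝ) + 1) ^ 2 := by
          have : 0 ≤ 1 / ((m : ℝ) + 1) ^ 2 := by positivity
          linarith
  · rw [ENNReal.tsum_mul_left]
    exact ENNReal.mul_lt_top hL.lt_top hsum.tsum_ofReal_lt_top

/-- The pairing repeats each coefficient on infinitely many pieces, so a single `c k ≠ 0` already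
makes the contributions at `Nat.pair k j` unbounded. -/
theorem not_memLp_blockSeq_comp {p q : ℝ≥0∞} (hp0 : p ≠ 0) (hpq : p < q) (hq : q ≠ ∞)
    (hs : Measurable s) (hL0 : L ≠ 0) (hL : L ≠ ∞)
    (hsL : ∀ n, μ (s ⁻¹' {n + 1}) = L * 2⁻¹ ^ (n + 2)) {c : ℕ → 𝕜} (hc : c ≠ 0) :
    ¬ MemLp (fun x => blockSeq p.toReal c (s x)) q μ := by
  rintro ⟨-, h⟩
  have hp : p ≠ ∞ := hpq.ne_top
  have hq0 : q ≠ 0 := (zero_le.trans_lt hpq).ne'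
  have hpr : 0 < p.toReal := ENNReal.toReal_pos hp0 hp
  have hqr : 0 < q.toReal := ENNReal.toReal_pos hq0 hq
  obtain ⟨k, hk⟩ := Function.ne_iff.1 hc
  have hk' : 0 < ‖c k‖ := norm_pos_iff.2 hk
  rw [eLpNorm_lt_top_iff_lintegral_rpow_enorm_lt_top hq0 hq,
    lintegral_comp_label hs hsL (fun n => ‖blockSeq p.toReal c n‖ₑ ^ q.toReal)
      (by simp [blockSeq, hqr])] at h
  set S := ∑' m, ‖blockSeq p.toReal c (m + 1)‖ₑ ^ q.toReal * (L * 2⁻¹ ^ (m + 2))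
  have hLr : 0 < L.toReal := ENNReal.toReal_pos hL0 hL
  have hbound : ∀ m, (Nat.unpair m).1 = k →
      ‖c k‖ ^ q.toReal * L.toReal * (((2 ^ m / ((m : ℝ) + 1) ^ 2) ^ p.toReal⁻¹) ^ q.toReal
        * (1 / 2 : ℝ) ^ (m + 2)) ≤ S.toReal := by
    intro m hm
    have h1 := ENNReal.toReal_mono h.ne (ENNReal.le_tsum
      (f := fun m => ‖blockSeq p.toReal c (m + 1)‖ₑ ^ q.toReal * (L * 2⁻¹ ^ (m + 2))) m)
    rw [ENNReal.toReal_mul, ENNReal.toReal_mul, ← ENNReal.toReal_rpow, toReal_enorm,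
      norm_blockSeq_succ, hm, Real.mul_rpow hk'.le (by positivity), inv_two_pow_eq_ofReal,
      ENNReal.toReal_ofReal (by positivity)] at h1
    refine le_of_eq_of_le ?_ h1
    ring
  have htend : Tendsto (fun j => Nat.pair k j) atTop atTop :=
    tendsto_atTop_mono (fun j => Nat.right_le_pair k j) tendsto_id
  have hT := ((tendsto_blockSeq_growth hpr ((ENNReal.toReal_lt_toReal hp hq).2 hpq)).comp
    htend).const_mul_atTop (mul_pos (Real.rpow_pos_of_pos hk' q.toReal) hLr)
  obtain ⟨j, hj⟩ := (hT.eventually_gt_atTop S.toReal).exists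
  exact (hbound (Nat.pair k j) (by simp)).not_gt hj

/-- The linear map sending `c` to the class of `blockSeq p c ∘ s`. -/
noncomputable def blockMap (𝕜 : Type*) [RCLike 𝕜] (μ : Measure X) (hs : Measurable s) (p : ℝ) :
    (ℕ → 𝕜) →ₗ[𝕜] (X →ₘ[μ] 𝕜) where
  toFun c := AEEqFun.mk (fun x => blockSeq p c (s x))
    (stronglyMeasurable_blockSeq_comp hs p c).aestronglyMeasurable
  map_add' c d := by
    rw [AEEqFun.mk_add_mk, AEEqFun.mk_eq_mk]
    refine Eventually.of_forall fun x => ?_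
    cases h : s x <;> simp [blockSeq, h, add_mul]
  map_smul' t c := by
    rw [RingHom.id_apply, AEEqFun.smul_mk, AEEqFun.mk_eq_mk]
    refine Eventually.of_forall fun x => ?_
    cases h : s x <;> simp [blockSeq, h, mul_assoc]

theorem coeFn_blockMap (hs : Measurable s) (p : ℝ) (c : ℕ → 𝕜) :
    blockMap 𝕜 μ hs p c =ᵐ[μ] fun x => blockSeq p c (s x) :=
  AEEqFun.coeFn_mk _ _

theorem exists_label_eq_of_ae (hL0 : L ≠ 0) (hsL : ∀ n, μ (s ⁻¹' {n + 1}) = L * 2⁻¹ ^ (n + 2))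
    {P : X → Prop} (hP : ∀ᵐ x ∂μ, P x) (n : ℕ) : ∃ x, s x = n + 1 ∧ P x := by
  have h : ∃ᵐ x ∂μ, x ∈ s ⁻¹' {n + 1} := by
    rw [frequently_ae_mem_iff, hsL]
    exact mul_ne_zero hL0 (by simp)
  obtain ⟨x, h1, h2⟩ := (h.and_eventually hP).exists
  exact ⟨x, h1, h2⟩

theorem blockMap_injective (hs : Measurable s) (p : ℝ) (hL0 : L ≠ 0)
    (hsL : ∀ n, μ (s ⁻¹' {n + 1}) = L * 2⁻¹ ^ (n + 2)) :
    Function.Injective (blockMap 𝕜 μ hs p) := by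
  rw [injective_iff_map_eq_zero]
  intro c hc
  ext k
  have h0 : ∀ᵐ x ∂μ, blockSeq p c (s x) = 0 := by
    filter_upwards [coeFn_blockMap (μ := μ) hs p c, AEEqFun.coeFn_zero (μ := μ) (β := 𝕜)]
      with x h1 h2
    rw [← h1, hc, h2, Pi.zero_apply]
  obtain ⟨x, hx, h⟩ := exists_label_eq_of_ae hL0 hsL h0 (Nat.pair k 0)
  rw [hx, ← norm_eq_zero, norm_blockSeq_succ, Nat.unpair_pair] at h
  exact norm_eq_zero.1 ((mul_eq_zero.1 h).resolve_right (by positivity))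

/-- Each piece has positive measure, so it contains a point of convergence, where the value is a
fixed nonzero multiple of one coefficient. Hence the coefficients converge. Since all sequences `c`
are admitted, their limit needs no bound. -/
theorem aeSeqClosed_range_blockMap (hs : Measurable s) (p : ℝ) (hL0 : L ≠ 0)
    (hsL : ∀ n, μ (s ⁻¹' {n + 1}) = L * 2⁻¹ ^ (n + 2)) :
    AESeqClosed (LinearMap.range (blockMap 𝕜 μ hs p)) := by
  intro v f hv hlim
  choose c hc using hv
  have hlim' : ∀ᵐ x ∂μ, Tendsto (fun j => blockSeq p (c j) (s x)) atTop (𝓝 (f x)) := by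
    have h := ae_all_iff.2 fun j => coeFn_blockMap (μ := μ) hs p (c j)
    filter_upwards [hlim, h] with x h1 h2
    exact h1.congr fun j => by rw [← hc j, h2 j]
  have hd : ∀ k, ∃ d, Tendsto (fun j => c j k) atTop (𝓝 d) := by
    intro k
    obtain ⟨x, hx, h⟩ := exists_label_eq_of_ae hL0 hsL hlim' (Nat.pair k 0)
    set w : ℝ := (2 ^ (Nat.pair k 0) / (((Nat.pair k 0 : ℕ) : ℝ) + 1) ^ 2) ^ p⁻¹ with hw
    have hw0 : (w : 𝕜) ≠ 0 := by
      have : 0 < w := by positivity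
      exact_mod_cast this.ne'
    refine ⟨f x * (w : 𝕜)⁻¹, (h.mul_const (w : 𝕜)⁻¹).congr fun j => ?_⟩
    rw [hx, blockSeq, Nat.unpair_pair, ← hw, mul_inv_cancel_right₀ hw0]
  choose d hd using hd
  refine ⟨d, AEEqFun.ext ?_⟩
  filter_upwards [hlim', coeFn_blockMap (μ := μ) hs p d] with x h1 h2
  rw [h2]
  refine tendsto_nhds_unique ?_ h1
  cases s x with
  | zero => exact tendsto_const_nhds
  | succ m => exact (hd _).mul_const _

end Label

/-! ### Common bounds and cardinality -/

/-- Finitely many functions are simultaneously bounded on a set of positive measure. -/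
theorem exists_bounded_on_of_fg {𝕜 X : Type*} [RCLike 𝕜] [MeasurableSpace X] {μ : Measure X}
    (hμ : μ ≠ 0) {F : Submodule 𝕜 (X →ₘ[μ] 𝕜)} (hF : F.FG) :
    ∃ B, MeasurableSet B ∧ μ B ≠ 0 ∧ ∀ u ∈ F, ∃ C : ℝ, ∀ᵐ x ∂μ, x ∈ B → ‖u x‖ ≤ C := by
  obtain ⟨S, rfl⟩ := hF
  let φ : X → ℝ := fun x => ∑ u ∈ S, ‖u x‖
  have hφ : Measurable φ := Finset.measurable_fun_sum _ fun u _ => u.measurable.norm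
  have hU : ⋃ M : ℕ, {x | φ x ≤ M} = univ :=
    eq_univ_of_forall fun x => mem_iUnion.2 (exists_nat_ge (φ x))
  obtain ⟨M, hM⟩ : ∃ M : ℕ, μ {x | φ x ≤ M} ≠ 0 := by
    by_contra! h
    have h0 := measure_iUnion_null h
    rw [hU, Measure.measure_univ_eq_zero] at h0
    exact hμ h0
  refine ⟨{x | φ x ≤ M}, measurableSet_le hφ measurable_const, hM, fun u hu => ?_⟩
  induction hu using Submodule.span_induction with
  | mem u hu =>
    exact ⟨M, Eventually.of_forall fun x hx =>
      (Finset.single_le_sum (f := fun u : X →ₘ[μ] 𝕜 => ‖u x‖)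
        (fun _ _ => norm_nonneg _) hu).trans hx⟩
  | zero =>
    refine ⟨0, ?_⟩
    filter_upwards [AEEqFun.coeFn_zero (μ := μ) (β := 𝕜)] with x hx _
    simp [hx]
  | add u v _ _ hu hv =>
    obtain ⟨C, hC⟩ := hu
    obtain ⟨D, hD⟩ := hv
    refine ⟨C + D, ?_⟩
    filter_upwards [hC, hD, AEEqFun.coeFn_add u v] with x h1 h2 h3 hx
    rw [h3]
    exact (norm_add_le _ _).trans (add_le_add (h1 hx) (h2 hx))
  | smul t u _ hu =>
    obtain ⟨C, hC⟩ := hu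
    refine ⟨‖t‖ * C, ?_⟩
    filter_upwards [hC, AEEqFun.coeFn_smul t u] with x h1 h2 hx
    rw [h2, Pi.smul_apply, norm_smul]
    exact mul_le_mul_of_nonneg_left (h1 hx) (norm_nonneg t)

/-- A representative is determined by its preimages of a countable basis, and there are at most `𝔠`
measurable sets. -/
theorem mk_aeEqFun_le_continuum {𝕜 X : Type*} [RCLike 𝕜] [mX : MeasurableSpace X]
    [MeasurableSpace.CountablyGenerated X] (μ : Measure X) : #(X →ₘ[μ] 𝕜) ≤ 𝔠 := by
  have hm : #{t : Set X | MeasurableSet t} ≤ 𝔠 := by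
    obtain ⟨b, hb, h⟩ := MeasurableSpace.CountablyGenerated.isCountablyGenerated (α := X)
    rw [h]
    exact MeasurableSpace.cardinal_measurableSet_le_continuum
      (hb.le_aleph0.trans Cardinal.aleph0_le_continuum)
  let U := TopologicalSpace.countableBasis 𝕜
  have hU := TopologicalSpace.isBasis_countableBasis 𝕜
  have : Countable U := (TopologicalSpace.countable_countableBasis 𝕜).to_subtype
  let Φ : (X →ₘ[μ] 𝕜) → U → {t : Set X | MeasurableSet t} := fun f V =>
    ⟨f ⁻¹' V, f.measurable (hU.isOpen V.2).measurableSet⟩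
  have hΦ : Function.Injective Φ := by
    intro f g hfg
    refine AEEqFun.ext (Eventually.of_forall fun x => ?_)
    by_contra hne
    obtain ⟨V, hV, hfV, hVs⟩ := hU.exists_subset_of_mem_open
      (show f x ∈ ({g x}ᶜ : Set 𝕜) from hne) isOpen_compl_singleton
    have h1 : f ⁻¹' V = g ⁻¹' V := congrArg Subtype.val (congrFun hfg ⟨V, hV⟩)
    have h2 : x ∈ g ⁻¹' V := h1 ▸ hfV
    exact hVs h2 rfl
  calc #(X →ₘ[μ] 𝕜) ≤ #(U → {t : Set X | MeasurableSet t}) := Cardinal.mk_le_of_injective hΦ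
    _ ≤ 𝔠 ^ ℵ₀ := by
      rw [Cardinal.mk_arrow]
      exact (Cardinal.power_le_power_right (by simpa using hm)).trans
        (Cardinal.power_le_power_left Cardinal.continuum_ne_zero (by simp))
    _ = 𝔠 := Cardinal.continuum_power_aleph0

theorem unitMeasure_ne_zero : unitMeasure ≠ 0 := by simp [Measure.restrict_eq_zero]

/-- The inclusion of `L_p[0,1]` in the space of classes of measurable functions. -/
noncomputable def lpUnitInclusion (𝕜 : Type*) [RCLike 𝕜] (p : ℝ≥0∞) :
    LpUnit 𝕜 p →ₗ[𝕜] (ℝ →ₘ[unitMeasure] 𝕜) where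
  toFun f := f
  map_add' _ _ := rfl
  map_smul' _ _ := rfl

/-- Dedekind's independence of characters, for the monoid `ℕ`. -/
theorem linearIndependent_pow_seq (𝕜 : Type*) [Field 𝕜] :
    LinearIndependent 𝕜 fun (t : 𝕜) (k : ℕ) => t ^ k :=
  ((linearIndependent_monoidHom (Multiplicative ℕ) 𝕜).comp (powersHom 𝕜)
    (powersHom 𝕜).injective :
      LinearIndependent 𝕜 fun t : 𝕜 => (powersHom 𝕜 t : Multiplicative ℕ → 𝕜))

/-! ### Finite dimension: the closed extension -/

theorem exists_closed_submodule_lpDiffLq {𝕜 : Type*} [RCLike 𝕜] {p : ℝ≥0∞} (hp0 : 0 < p)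
    (hp : p < ∞) {F : Submodule 𝕜 (LpUnit 𝕜 p)} (hF : F.FG)
    (hFA : (F : Set (LpUnit 𝕜 p)) ⊆ lpDiffLq 𝕜 p ∪ {0}) :
    ∃ G : Submodule 𝕜 (LpUnit 𝕜 p), Module.rank 𝕜 G = 𝔠 ∧
      IsClosed[lpUnitTopology 𝕜 p] (G : Set (LpUnit 𝕜 p)) ∧ F ≤ G ∧
      (G : Set (LpUnit 𝕜 p)) ⊆ lpDiffLq 𝕜 p ∪ {0} := by
  obtain ⟨B, hB, hνB, hbd⟩ := exists_bounded_on_of_fg unitMeasure_ne_zero (hF.map (lpUnitInclusion 𝕜 p))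
  obtain ⟨s, hs, hsB, hsL⟩ := exists_measurable_label unitMeasure hB hνB
  have hνB' : unitMeasure B ≠ ∞ := measure_ne_top _ _
  let J := blockMap 𝕜 unitMeasure hs p.toReal
  let V := LinearMap.range J ⊔ F.map (lpUnitInclusion 𝕜 p)
  have hV : AESeqClosed V :=
    (aeSeqClosed_range_blockMap hs p.toReal hνB hsL).sup_fg (hF.map _)
  refine ⟨V.comap (lpUnitInclusion 𝕜 p), le_antisymm ?_ ?_, hV.isClosed_comap hp0.ne', ?_, ?_⟩
  · exact (rank_le_card _ _).trans ((Cardinal.mk_le_of_injective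
      (Subtype.val_injective.comp Subtype.val_injective)).trans
        (mk_aeEqFun_le_continuum unitMeasure))
  -- Ratios in `(0, 1)` keep the coefficients bounded by `1`, so these images lie in `L_p`.
  · let c : Ioo (0 : ℝ) 1 → ℕ → 𝕜 := fun t k => ((t : ℝ) : 𝕜) ^ k
    have hc : LinearIndependent 𝕜 c := (linearIndependent_pow_seq 𝕜).comp
      (fun t : Ioo (0 : ℝ) 1 => ((t : ℝ) : 𝕜)) fun t t' h => Subtype.ext (RCLike.ofReal_injective h)
    have hmem : ∀ t, J (c t) ∈ Lp 𝕜 p unitMeasure := fun t =>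
      Lp.mem_Lp_iff_memLp.2 ((memLp_congr_ae (coeFn_blockMap hs _ _)).2
        (memLp_blockSeq_comp hp0.ne' hp.ne hs hνB' hsL fun k => by
          rw [norm_pow, RCLike.norm_ofReal, abs_of_pos t.2.1]
          exact pow_le_one₀ t.2.1.le t.2.2.le))
    let v : Ioo (0 : ℝ) 1 → V.comap (lpUnitInclusion 𝕜 p) := fun t =>
      ⟨⟨J (c t), hmem t⟩, le_sup_left (a := LinearMap.range J) ⟨c t, rfl⟩⟩
    have hv : LinearIndependent 𝕜 v := by
      refine LinearIndependent.of_comp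
        ((lpUnitInclusion 𝕜 p).comp (V.comap (lpUnitInclusion 𝕜 p)).subtype) ?_
      exact hc.map' J (LinearMap.ker_eq_bot.2 (blockMap_injective hs _ hνB hsL))
    have h := hv.cardinal_lift_le_rank
    rwa [Cardinal.mk_Ioo_real one_pos, Cardinal.lift_continuum, Cardinal.lift_id'.{0}] at h
  · exact fun f hf => Submodule.mem_sup_right (Submodule.mem_map_of_mem hf)
  · intro g hg
    obtain ⟨_, ⟨c, rfl⟩, _, ⟨u, hu, rfl⟩, hcu⟩ := Submodule.mem_sup.1 (show _ ∈ V from hg)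
    by_cases hu0 : u = 0
    · rw [hu0, map_zero, add_zero] at hcu
      by_cases hc0 : c = 0
      · right
        rw [hc0, map_zero] at hcu
        exact Subtype.ext hcu.symm
      · left
        rw [mem_lpDiffLq_iff]
        intro q hpq hq hgq
        refine not_memLp_blockSeq_comp hp0.ne' hpq hq.ne hs hνB hνB' hsL hc0
          ((memLp_congr_ae ?_).1 hgq)
        have h2 : (g : ℝ →ₘ[unitMeasure] 𝕜) = J c := hcu.symm
        rw [h2]
        exact coeFn_blockMap hs p.toReal c
    · left
      have huA : u ∈ lpDiffLq 𝕜 p := (hFA hu).resolve_right hu0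
      rw [mem_lpDiffLq_iff] at huA ⊢
      intro q hpq hq hgq
      obtain ⟨C, hC⟩ := hbd _ (Submodule.mem_map_of_mem hu)
      have h1 : MemLp (B.indicator u) q unitMeasure := by
        refine MemLp.of_bound ((Lp.aestronglyMeasurable u).indicator hB) (max C 0) ?_
        filter_upwards [hC] with x hx
        by_cases hxB : x ∈ B
        · rw [indicator_of_mem hxB]
          exact (hx hxB).trans (le_max_left _ _)
        · simp [indicator_of_notMem hxB]
      refine huA q hpq hq ((memLp_congr_ae ?_).1 (h1.add (hgq.indicator hB.compl)))
      have hg' : (g : ℝ → 𝕜) =ᵐ[unitMeasure] fun x => blockSeq p.toReal c (s x) + u x := by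
        have h2 : (g : ℝ →ₘ[unitMeasure] 𝕜) = J c + u := hcu.symm
        rw [h2]
        filter_upwards [AEEqFun.coeFn_add (J c) (u : ℝ →ₘ[unitMeasure] 𝕜),
          coeFn_blockMap hs p.toReal c] with x h3 h4
        rw [h3, Pi.add_apply, h4]
      filter_upwards [hg'] with x hx
      by_cases hxB : x ∈ B
      · simp [hxB]
      · simp [hxB, hx, hsB x hxB, blockSeq]

/-! ### Infinite dimension: the obstruction -/

theorem lpUnit_norm_smul {𝕜 : Type*} [RCLike 𝕜] {p : ℝ≥0∞} (t : 𝕜) (f : LpUnit 𝕜 p) :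
    ‖t • f‖ = ‖t‖ * ‖f‖ := by
  rw [Lp.norm_def, Lp.norm_def, eLpNorm_congr_ae (Lp.coeFn_smul t f), eLpNorm_const_smul,
    ENNReal.toReal_mul, toReal_enorm]

theorem exists_submodule_not_le_closed {𝕜 : Type*} [RCLike 𝕜] {p : ℝ≥0∞} (hp : p < ∞)
    {F₀ : Submodule 𝕜 (LpUnit 𝕜 p)} (hF₀ : ℵ₀ ≤ Module.rank 𝕜 F₀)
    (hF₀A : (F₀ : Set (LpUnit 𝕜 p)) \ {0} ⊆ lpDiffLq 𝕜 p) :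
    ∃ F : Submodule 𝕜 (LpUnit 𝕜 p), Module.rank 𝕜 F = Module.rank 𝕜 F₀ ∧
      (F : Set (LpUnit 𝕜 p)) ⊆ lpDiffLq 𝕜 p ∪ {0} ∧
      ∀ G : Submodule 𝕜 (LpUnit 𝕜 p), IsClosed[lpUnitTopology 𝕜 p] (G : Set (LpUnit 𝕜 p)) →
        F ≤ G → ¬ (G : Set (LpUnit 𝕜 p)) ⊆ lpDiffLq 𝕜 p ∪ {0} := by
  let b := Module.Basis.ofVectorSpace 𝕜 F₀
  have hinf : Infinite (Module.Basis.ofVectorSpaceIndex 𝕜 F₀) := by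
    rwa [Cardinal.infinite_iff, b.mk_eq_rank'']
  let e := Infinite.natEmbedding (Module.Basis.ofVectorSpaceIndex 𝕜 F₀)
  -- Chosen so that `‖b (e n)‖ / r n < 1 / (n + 1)`; hence `(r n)⁻¹ • T (b (e n))` tends to `one`.
  let r : ℕ → ℝ := fun n => ((n : ℝ) + 1) * (‖(b (e n) : LpUnit 𝕜 p)‖ + 1)
  have hnn : ∀ f : LpUnit 𝕜 p, 0 ≤ ‖f‖ := fun f => ENNReal.toReal_nonneg
  have hr : ∀ n, 0 < r n := fun n =>
    mul_pos n.cast_add_one_pos (add_pos_of_nonneg_of_pos (hnn _) one_pos)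
  let ψ : F₀ →ₗ[𝕜] 𝕜 := b.constr 𝕜 (Function.extend e (fun n => (r n : 𝕜)) 0)
  have hψ : ∀ n, ψ (b (e n)) = (r n : 𝕜) := fun n => by
    rw [Module.Basis.constr_basis, e.injective.extend_apply]
  let one : LpUnit 𝕜 p := (memLp_const (1 : 𝕜)).toLp _
  have hone : (one : ℝ → 𝕜) =ᵐ[unitMeasure] fun _ => 1 := MemLp.coeFn_toLp _
  let T : F₀ →ₗ[𝕜] LpUnit 𝕜 p := F₀.subtype + ψ.smulRight one
  have hT : ∀ x, T x = (x : LpUnit 𝕜 p) + ψ x • one := fun x => rfl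
  have hTA : ∀ x, x ≠ 0 → T x ∈ lpDiffLq 𝕜 p := by
    intro x hx
    have hxA : (x : LpUnit 𝕜 p) ∈ lpDiffLq 𝕜 p :=
      hF₀A ⟨x.2, fun h => hx (Subtype.ext h)⟩
    rw [mem_lpDiffLq_iff] at hxA ⊢
    intro q hpq hq hTq
    refine hxA q hpq hq ((memLp_congr_ae ?_).1 (hTq.sub (memLp_const (ψ x))))
    rw [hT]
    filter_upwards [Lp.coeFn_add (x : LpUnit 𝕜 p) (ψ x • one), Lp.coeFn_smul (ψ x) one, hone]
      with y h1 h2 h3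
    rw [Pi.sub_apply, h1, Pi.add_apply, h2, Pi.smul_apply, h3, smul_eq_mul, mul_one,
      add_sub_cancel_right]
  have hzero : (0 : LpUnit 𝕜 p) ∉ lpDiffLq 𝕜 p := by
    rw [mem_lpDiffLq_iff]
    intro h
    exact h (p + 1) (ENNReal.lt_add_right hp.ne one_ne_zero) (by finiteness)
      ((memLp_congr_ae (Lp.coeFn_zero 𝕜 p unitMeasure)).2 MemLp.zero)
  have hTinj : Function.Injective T := by
    rw [injective_iff_map_eq_zero]
    intro x hx
    by_contra hx0
    exact hzero (hx ▸ hTA x hx0)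
  refine ⟨LinearMap.range T, rank_range_of_injective T hTinj, ?_, fun G hG hTG hGA => ?_⟩
  · rintro _ ⟨x, rfl⟩
    by_cases hx : x = 0
    · right
      rw [hx, map_zero]
      rfl
    · exact Or.inl (hTA x hx)
  · have h1 : one ∈ G := by
      by_contra h1
      let := lpUnitTopology 𝕜 p
      obtain ⟨ε, hε, hball⟩ := (isOpen_compl_iff.2 hG : IsOpen _) one h1
      obtain ⟨n, hn⟩ := exists_nat_one_div_lt hε
      have hr' : (r n : 𝕜) ≠ 0 := by exact_mod_cast (hr n).ne'
      refine hball ((r n : 𝕜)⁻¹ • T (b (e n))) ?_ (G.smul_mem _ (hTG ⟨_, rfl⟩))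
      have : (r n : 𝕜)⁻¹ • T (b (e n)) - one = (r n : 𝕜)⁻¹ • (b (e n) : LpUnit 𝕜 p) := by
        rw [hT, hψ, smul_add, inv_smul_smul₀ hr', add_sub_cancel_right]
      rw [this, lpUnit_norm_smul, norm_inv, RCLike.norm_ofReal, abs_of_pos (hr n)]
      refine lt_of_le_of_lt ?_ hn
      rw [inv_mul_eq_div, div_le_div_iff₀ (hr n) n.cast_add_one_pos]
      have := hnn (b (e n) : LpUnit 𝕜 p)
      have h2 : (0 : ℝ) < n + 1 := n.cast_add_one_pos
      simp only [r]
      nlinarith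
    rcases hGA h1 with h | h
    · rw [mem_lpDiffLq_iff] at h
      exact h (p + 1) (ENNReal.lt_add_right hp.ne one_ne_zero) (by finiteness)
        ((memLp_congr_ae hone).2 (memLp_const 1))
    · have h0 : ∀ᵐ _x ∂unitMeasure, False := by
        filter_upwards [hone, Lp.coeFn_zero 𝕜 p unitMeasure] with x h2 h3
        rw [mem_singleton_iff] at h
        rw [h, h3] at h2
        exact zero_ne_one h2
      exact unitMeasure_ne_zero (ae_eq_bot.1 (eventually_false_iff_eq_bot.1 h0))

theorem theorem2p1 {𝕜 : Type*} [RCLike 𝕜] (p : ℝ≥0∞) (hp0 : 0 < p) (hp : p < ∞)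
    (α : Cardinal) :
    IsSpaceable 𝕜 (lpUnitTopology 𝕜 p) (lpDiffLq 𝕜 p) α 𝔠 ↔ α < ℵ₀ := by
  constructor
  · rintro ⟨-, ⟨F₀, hF₀, hF₀A⟩, hG⟩
    by_contra! hα
    obtain ⟨F, hF, hFA, hno⟩ := exists_submodule_not_le_closed hp (hF₀ ▸ hα) hF₀A
    obtain ⟨G, -, hGc, hFG, hGA⟩ := hG F (hF.trans hF₀) hFA
    exact hno G hGc hFG hGA
  · intro hα
    have hαc : α ≤ 𝔠 := hα.le.trans Cardinal.aleph0_le_continuum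
    refine ⟨hαc, ?_, fun F hF hFA => exists_closed_submodule_lpDiffLq hp0 hp ?_ hFA⟩
    -- Extending the zero space gives dimension `𝔠`, hence subspaces of every smaller dimension.
    · obtain ⟨G, hG, -, -, hGA⟩ := exists_closed_submodule_lpDiffLq hp0 hp
        (F := (⊥ : Submodule 𝕜 (LpUnit 𝕜 p))) Submodule.fg_bot (by simp)
      obtain ⟨S, hS, hSi⟩ := le_rank_iff_exists_linearIndependent.1 (hαc.trans hG.ge)
      refine ⟨(Submodule.span 𝕜 S).map G.subtype, ?_, ?_⟩
      · rw [rank_map_eq G.injective_subtype, rank_span_set hSi, hS]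
      · rintro _ ⟨⟨x, -, rfl⟩, hx⟩
        exact (hGA x.2).resolve_right hx
    · rw [← Module.Finite.iff_fg]
      exact Module.rank_lt_aleph0_iff.1 (hF ▸ hα)
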